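/- Let $k\ge 2$, $n,d\in\mathbb N$. A graph is a directed, vertex-coloured graph $G=(V(G),E(G),\chi_G)$ with $V(G)=[n]$. The $k$-WL test colours $k$-tuples: $\chi^{(0)}_{G,k}(\bar v)$ is the isomorphism type of $\bar v$ (the vertex colours $\chi_G(v_i)$, together with the information which entries are equal and which pairs $(v_i,v_j)$ are edges), and $\chi^{(t+1)}_{G,k}(\bar v)$ is an injective encoding (the same for all graphs) of the pair consisting of $\chi^{(t)}_{G,k}(\bar v)$ and the $k$-tuple of multisets $\{\!\!\{\chi^{(t)}_{G,k}(v_1,\ldots,v_{i-1},u,v_{i+1},\ldots,v_k)\mid u\in[n]\}\!\!\}$, $i=1,\ldots,k$. Write $G\equiv^t_{k\text{-WL}}H$ if $\{\!\!\{\chi^{(t)}_{G,k}(\bar v)\mid\bar v\in[n]^k\}\!\!\}=\{\!\!\{\chi^{(t)}_{H,k}(\bar w)\mid\bar w\in[n]^k\}\!\!\}$. A $k$-IGN with $d$ equivariant layers is a function $F=M\circ I\circ\sigma\circ L^{(d)}\circ\cdots\circ\sigma\circ L^{(1)}:\mathbb R^{n^k\times s_0}\to\mathbb R^s$, where each $L^{(i)}:\mathbb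 R^{n^k\times s_{i-1}}\to\mathbb R^{n^k\times s_i}$ is a linear layer (an affine map, that is, a bias is allowed) which is equivariant under the permutations of $[n]$, $\sigma$ is an activation function $\mathbb R\to\mathbb R$ applied entrywise, $I:\mathbb R^{n^k\times s_d}\to\mathbb R^{s_{d+1}}$ is a linear layer (bias allowed) which is invariant under the permutations of $[n]$, and $M:\mathbb R^{s_{d+1}}\to\mathbb R^s$ is a multilayer perceptron. Put $F^{(m)}=\sigma\circ L^{(m)}\circ\cdots\circ\sigma\circ L^{(1)}$ for $0\le m\le d$, with $F^{(0)}$ the identity. Let $F$ be such a $k$-IGN, let $G$ and $H$ be graphs with vertex set $[n]$, let $c_1,\ldots,c_{s_0}$ be distinct isomorphism types that include all those of the $k$-tuples of $G$ and of $H$, and let $\mathbf A_G,\mathbf A_H\in\mathbb R^{n^k\times s_0}$ be the corresponding one-hot encodings of the initial colourings: $(\mathbf A_G)_{\bar v,s}=1$ if $\chi^{(0)}_{G,k}(\bar v)=c_s$, and $0$ otherwise; likewise for $H$. Then for every integer $t\ge 0$ with $m:=\lfloor t/(k-1)\rfloor\le d$: if $G\equiv^t_{k\text{-WL}}H$, then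 $$\{\!\!\{F^{(m)}(\mathbf A_G)_{\bar v,\bullet}\mid\bar v\in[n]^k\}\!\!\}=\{\!\!\{F^{(m)}(\mathbf A_H)_{\bar w,\bullet}\mid\bar w\in[n]^k\}\!\!\},$$ and, more strongly, for all $\bar v,\bar w\in[n]^k$, $$\chi^{(t)}_{G,k}(\bar v)=\chi^{(t)}_{H,k}(\bar w)\ \Longrightarrow\ F^{(m)}(\mathbf A_G)_{\bar v,\bullet}=F^{(m)}(\mathbf A_H)_{\bar w,\bullet}.$$ -/

import Mathlib

/-- A directed graph (loops allowed) with vertex set `[n]` whose vertices carry colours in `C`. -/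
structure ColouredGraph (n : ℕ) (C : Type*) where
  /-- the edge relation -/
  graph : Digraph (Fin n)
  /-- the vertex colouring -/
  colour : Fin n → C

/-- The data describing the isomorphism type of (the coloured graph induced by) a `k`-tuple:
the vertex colours, the equalities and the edges between its entries. -/
@[ext]
structure IsoType (k : ℕ) (C : Type*) where
  col : Fin k → C
  eq : Fin k → Fin k → Prop
  adj : Fin k → Fin k → Prop

/-- The isomorphism type of a `k`-tuple of vertices. -/
def ColouredGraph.isoType {n k : ℕ} {C : Type*} (G : ColouredGraph n C) (v : Fin k → Fin n) :
    IsoType k C where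
  col i := G.colour (v i)
  eq i j := v i = v j
  adj i j := G.graph.Adj (v i) (v j)

/-- The colours used by `k`-WL in round `t`. A round-`(t + 1)` colour is the pair consisting of the
previous colour and the `k`-tuple of multisets of previous colours of the neighbours; thus the
hash function is the tautological injective one, and is the same for all graphs. -/
def WLColour (k : ℕ) (C : Type*) : ℕ → Type _
  | 0 => IsoType k C
  | t + 1 => WLColour k C t × (Fin k → Multiset (WLColour k C t))

/-- The colouring of `k`-tuples produced by `k`-WL after `t` rounds. -/
def ColouredGraph.wl {n k : ℕ} {C : Type*} (G : ColouredGraph n C) :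
    (t : ℕ) → (Fin k → Fin n) → WLColour k C t
  | 0, v => G.isoType v
  | t + 1, v =>
    (G.wl t v,
      fun i => (Finset.univ : Finset (Fin n)).val.map fun u => G.wl t (Function.update v i u))

/-- `k`-WL does not distinguish `G` and `H` in round `t`. -/
def WLEquiv {n m : ℕ} {C : Type*} (k t : ℕ) (G : ColouredGraph n C) (H : ColouredGraph m C) :
    Prop :=
  (Finset.univ : Finset (Fin k → Fin n)).val.map (fun v => G.wl t v) =
    (Finset.univ : Finset (Fin k → Fin m)).val.map (fun w => H.wl t w)

/-- `k`-th order tensors over `[n]` with `p` features: `ℝ^{n^k × p}`. -/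
abbrev FeatureTensor (n k p : ℕ) : Type := (Fin k → Fin n) → Fin p → ℝ

/-- The action of permutations on tensors, `(π ⋆ A)_{π(v)} = A_v`. -/
def FeatureTensor.perm {n k p : ℕ} (π : Equiv.Perm (Fin n)) (A : FeatureTensor n k p) :
    FeatureTensor n k p :=
  fun v => A fun i => π.symm (v i)

/-- Equivariant linear layers. As usual for network layers, "linear" allows a bias term. -/
structure EquivariantLayer (n k l p q : ℕ) where
  toAffineMap : FeatureTensor n k p →ᵃ[ℝ] FeatureTensor n l q
  equivariant : ∀ (π : Equiv.Perm (Fin n)) (A : FeatureTensor n k p),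
    toAffineMap (A.perm π) = (toAffineMap A).perm π

/-- Invariant linear layers (again, a bias term is allowed). -/
structure InvariantLayer (n k p q : ℕ) where
  toAffineMap : FeatureTensor n k p →ᵃ[ℝ] (Fin q → ℝ)
  invariant : ∀ (π : Equiv.Perm (Fin n)) (A : FeatureTensor n k p),
    toAffineMap (A.perm π) = toAffineMap A

/-- Multilayer perceptrons: affine maps alternating with pointwise activation functions. -/
inductive IsMLP : {p q : ℕ} → ((Fin p → ℝ) → (Fin q → ℝ)) → Prop
  | affine {p q : ℕ} (L : (Fin p → ℝ) →ᵃ[ℝ] (Fin q → ℝ)) : IsMLP fun x => L x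
  | layer {p q r : ℕ} (L : (Fin p → ℝ) →ᵃ[ℝ] (Fin r → ℝ)) (ρ : ℝ → ℝ)
      {g : (Fin r → ℝ) → (Fin q → ℝ)} (hg : IsMLP g) : IsMLP fun x => g fun i => ρ (L x i)

/-- A `k`-th order invariant graph network on tensors over `[n]`, with `d` equivariant layers and
output in `ℝ^s`. Only the widths `s_0, …, s_{d+1}` matter; `layer i` is the `(i + 1)`-st layer. -/
structure IGN (n k d s : ℕ) where
  width : ℕ → ℕ
  layer : (i : ℕ) → i < d → EquivariantLayer n k k (width i) (width (i + 1))
  activation : ℝ → ℝ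
  invLayer : InvariantLayer n k (width d) (width (d + 1))
  mlp : (Fin (width (d + 1)) → ℝ) → (Fin s → ℝ)
  mlp_isMLP : IsMLP mlp

/-- The first `m` layers of the network,
`F^{(m)} = σ ∘ L^{(m)} ∘ ⋯ ∘ σ ∘ L^{(1)}`, with `F^{(0)}` the identity. -/
def IGN.feature {n k d s : ℕ} (F : IGN n k d s) :
    (m : ℕ) → m ≤ d → FeatureTensor n k (F.width 0) → FeatureTensor n k (F.width m)
  | 0, _, A => A
  | m + 1, hm, A => fun v a =>
    F.activation ((F.layer m hm).toAffineMap (F.feature m (Nat.le_of_succ_le hm) A) v a)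

/-- The function `F = M ∘ I ∘ F^{(d)}` computed by the network. -/
def IGN.eval {n k d s : ℕ} (F : IGN n k d s) (A : FeatureTensor n k (F.width 0)) : Fin s → ℝ :=
  F.mlp (F.invLayer.toAffineMap (F.feature d le_rfl A))

open Classical in
/-- The one-hot encoding of the initial `k`-WL colouring of `G`, with respect to an enumeration
`c` of colours. -/
noncomputable def ColouredGraph.tensor {n k p : ℕ} {C : Type*} (G : ColouredGraph n C)
    (c : Fin p → IsoType k C) : FeatureTensor n k p :=
  fun v s => if G.isoType v = c s then 1 else 0

/-- The feature vectors computed by the first `m` layers of `F` on `A` and on `B` agree as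
multisets. -/
def IGN.FeatureEquiv {n k d s : ℕ} (F : IGN n k d s) (m : ℕ) (hm : m ≤ d)
    (A B : FeatureTensor n k (F.width 0)) : Prop :=
  (Finset.univ : Finset (Fin k → Fin n)).val.map (fun v => F.feature m hm A v) =
    (Finset.univ : Finset (Fin k → Fin n)).val.map (fun w => F.feature m hm B w)

/-! The linear part of an equivariant layer is a kernel `T (v, u)` summed against `A u`, and `T` is
invariant under permuting `[n]`, so it depends only on the equality pattern of the `2k`-tuple.
Möbius inversion writes `T` as a combination of indicators `P ≤ ker (v, u)`
(`exists_sum_le_ker_eq`). Such conditions only impose equalities, so the sum for one `P` becomes an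
unrestricted sum of `A (x ∘ f)` over the tuples `x` got from `v` by freeing a set `S` of positions
(`exists_sum_pattern_eq`).

Each freed position costs one round of `k`-WL, and substitution along `f` costs none (`wl_comp_eq`).
If all `k` positions are freed, the sum ignores `v` and is settled by the equivalence of the graphs.
Hence `k - 1` rounds pay for one layer (`sum_variants_eq`), and induction on layers finishes. -/

lemma exists_perm_of_map_univ_eq {α β : Type*} [Fintype α] {f g : α → β}
    (h : (Finset.univ : Finset α).val.map f = (Finset.univ : Finset α).val.map g) :
    ∃ σ : Equiv.Perm α, ∀ a, f a = g (σ a) := by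
  classical
  have hcard : ∀ b, Fintype.card {a // f a = b} = Fintype.card {a // g a = b} := by
    intro b
    have hb := congrArg (Multiset.count b) h
    rw [Multiset.count_map, Multiset.count_map] at hb
    simp only [Fintype.card_subtype, eq_comm (b := b)]
    exact hb
  exact ⟨Equiv.ofFiberEquiv fun b => Fintype.equivOfCardEq (hcard b),
    fun a => (Equiv.ofFiberEquiv_map _ a).symm⟩

lemma map_univ_eq_of_perm {α β : Type*} [Fintype α] {f g : α → β} (σ : Equiv.Perm α)
    (h : ∀ a, f a = g (σ a)) :
    (Finset.univ : Finset α).val.map f = (Finset.univ : Finset α).val.map g := by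
  conv_rhs => rw [← Multiset.map_univ_val_equiv σ, Multiset.map_map]
  rw [funext h, Function.comp_def]

/-! ### Refinement and substitution for `k`-WL colours. -/

namespace ColouredGraph

variable {n k : ℕ} {C : Type*} {G H : ColouredGraph n C}

lemma wl_eq_of_le {s t : ℕ} (hst : s ≤ t) {v w : Fin k → Fin n}
    (h : G.wl t v = H.wl t w) : G.wl s v = H.wl s w := by
  induction t, hst using Nat.le_induction with
  | base => exact h
  | succ t _ ih => exact ih (congrArg Prod.fst h)

lemma exists_perm_wl_update {t : ℕ} {v w : Fin k → Fin n}
    (h : G.wl (t + 1) v = H.wl (t + 1) w) (i : Fin k) :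
    ∃ σ : Equiv.Perm (Fin n), ∀ u,
      G.wl t (Function.update v i u) = H.wl t (Function.update w i (σ u)) := by
  have h' := congrFun (congrArg Prod.snd h) i
  exact exists_perm_of_map_univ_eq (f := fun u => G.wl t (Function.update v i u))
    (g := fun u => H.wl t (Function.update w i u)) h'

lemma wl_succ_eq {t : ℕ} {v w : Fin k → Fin n} (h : G.wl t v = H.wl t w)
    (hσ : ∀ i, ∃ σ : Equiv.Perm (Fin n), ∀ u,
      G.wl t (Function.update v i u) = H.wl t (Function.update w i (σ u))) :
    G.wl (t + 1) v = H.wl (t + 1) w := by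
  refine Prod.ext h (funext fun i => ?_)
  obtain ⟨σ, hσ⟩ := hσ i
  exact map_univ_eq_of_perm σ hσ

/-- The colour of a tuple determines the colours of all tuples formed from its entries. -/
lemma wl_comp_eq {t : ℕ} {v w : Fin k → Fin n} (h : G.wl t v = H.wl t w) (f : Fin k → Fin k) :
    G.wl t (v ∘ f) = H.wl t (w ∘ f) := by
  induction t generalizing v w f with
  | zero =>
    have h : G.isoType v = H.isoType w := h
    refine IsoType.ext (funext fun i => ?_) (funext fun i => funext fun j => ?_)
      (funext fun i => funext fun j => ?_)
    · exact congrFun (congrArg IsoType.col h) (f i)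
    · exact congrFun (congrFun (congrArg IsoType.eq h) (f i)) (f j)
    · exact congrFun (congrFun (congrArg IsoType.adj h) (f i)) (f j)
  | succ t ih =>
    refine wl_succ_eq (ih (wl_eq_of_le t.le_succ h) f) fun i => ?_
    -- Pigeonhole: the other `k - 1` positions cannot use all `k` entries, so some entry `j` is
    -- spare. Overwriting it and redirecting `i` to it simulates the update of `x ∘ f` at `i`.
    obtain ⟨j, hj⟩ : ∃ j, j ∉ (Finset.univ.erase i).image f := by
      by_contra! hall
      have h1 := Finset.card_le_card (fun j _ => hall j : Finset.univ ⊆ (Finset.univ.erase i).image f)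
      have h2 := Finset.card_image_le (s := Finset.univ.erase i) (f := f)
      have h3 := Finset.card_erase_lt_of_mem (Finset.mem_univ i)
      omega
    have key : ∀ (x : Fin k → Fin n) (u : Fin n),
        Function.update (x ∘ f) i u = Function.update x j u ∘ Function.update f i j := by
      intro x u
      ext1 l
      by_cases hl : l = i
      · subst hl; simp
      · have : f l ≠ j := fun hfl => hj (Finset.mem_image.2 ⟨l, by simp [hl], hfl⟩)
        simp [hl, this]
    obtain ⟨σ, hσ⟩ := exists_perm_wl_update h j
    refine ⟨σ, fun u => ?_⟩
    rw [key, key]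
    exact ih (hσ u) _

lemma exists_perm_wl {t : ℕ} (h : WLEquiv k t G H) :
    ∃ σ : Equiv.Perm (Fin k → Fin n), ∀ v, G.wl t v = H.wl t (σ v) := by
  exact exists_perm_of_map_univ_eq h

lemma ker_eq_of_wl_eq {t : ℕ} {v w : Fin k → Fin n} (h : G.wl t v = H.wl t w) :
    Setoid.ker v = Setoid.ker w := by
  have h : G.isoType v = H.isoType w := wl_eq_of_le t.zero_le h
  ext i j
  exact iff_of_eq (congrFun (congrFun (congrArg IsoType.eq h) i) j)

end ColouredGraph

lemma WLEquiv.mono {n k : ℕ} {C : Type*} {G H : ColouredGraph n C} {s t : ℕ} (hst : s ≤ t)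
    (h : WLEquiv k t G H) : WLEquiv k s G H := by
  obtain ⟨σ, hσ⟩ := ColouredGraph.exists_perm_wl h
  exact map_univ_eq_of_perm σ fun v => ColouredGraph.wl_eq_of_le hst (hσ v)

/-! ### Sums over tuples with some positions freed. -/

namespace ColouredGraph

variable {n k : ℕ} {C : Type*} {G H : ColouredGraph n C}

/-- The tuples obtained from `v` by changing entries at positions in `S`. -/
def variants (S : Finset (Fin k)) (v : Fin k → Fin n) : Finset (Fin k → Fin n) :=
  {x | ∀ i ∉ S, x i = v i}

lemma mem_variants {S : Finset (Fin k)} {v x : Fin k → Fin n} :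
    x ∈ variants S v ↔ ∀ i ∉ S, x i = v i := by
  simp [variants]

lemma sum_variants_insert {M : Type*} [AddCommMonoid M] {S : Finset (Fin k)} {i : Fin k}
    (hi : i ∉ S) (v : Fin k → Fin n) (A : (Fin k → Fin n) → M) :
    ∑ x ∈ variants (insert i S) v, A x = ∑ u, ∑ x ∈ variants S (Function.update v i u), A x := by
  rw [← Finset.sum_fiberwise _ (fun x => x i)]
  refine Finset.sum_congr rfl fun u _ => Finset.sum_congr ?_ fun _ _ => rfl
  ext x
  simp only [Finset.mem_filter, mem_variants, Finset.mem_insert, not_or]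
  constructor
  · rintro ⟨h, rfl⟩ j hj
    by_cases hji : j = i
    · subst hji; simp
    · simp [hji, h j ⟨hji, hj⟩]
  · intro h
    refine ⟨fun j hj => ?_, by simpa using h i hi⟩
    simpa [hj.1] using h j hj.2

/-- Positions are freed one at a time; each uses one round, whose multiset matches the new entries
for `v` with those for `w`. -/
lemma sum_variants_eq_of_wl_eq {M : Type*} [AddCommMonoid M] {s : ℕ}
    {A B : (Fin k → Fin n) → M} (hAB : ∀ x y, G.wl s x = H.wl s y → A x = B y)
    (S : Finset (Fin k)) {v w : Fin k → Fin n} (h : G.wl (s + S.card) v = H.wl (s + S.card) w) :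
    ∑ x ∈ variants S v, A x = ∑ y ∈ variants S w, B y := by
  induction S using Finset.induction_on generalizing v w with
  | empty =>
    have hv : ∀ v : Fin k → Fin n, variants ∅ v = {v} := fun v => by
      ext x; simp [mem_variants, funext_iff]
    simpa [hv] using hAB v w h
  | insert i S hi ih =>
    rw [Finset.card_insert_of_notMem hi, ← add_assoc] at h
    obtain ⟨σ, hσ⟩ := exists_perm_wl_update h i
    rw [sum_variants_insert hi, sum_variants_insert hi,
      ← Equiv.sum_comp σ (fun u => ∑ y ∈ variants S (Function.update w i u), B y)]
    exact Finset.sum_congr rfl fun u _ => ih (hσ u)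

/-- With `k - 1` further rounds, sums over variants are determined for every set of positions;
when all positions vary this is the equivalence of the two graphs. -/
lemma sum_variants_eq {M : Type*} [AddCommMonoid M] {s : ℕ}
    {A B : (Fin k → Fin n) → M} (hAB : ∀ x y, G.wl s x = H.wl s y → A x = B y)
    (hGH : WLEquiv k s G H) (S : Finset (Fin k)) {v w : Fin k → Fin n}
    (h : G.wl (s + (k - 1)) v = H.wl (s + (k - 1)) w) :
    ∑ x ∈ variants S v, A x = ∑ y ∈ variants S w, B y := by
  by_cases hS : S = Finset.univ
  · have hv : ∀ v : Fin k → Fin n, variants S v = Finset.univ := fun v => by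
      ext x; simp [mem_variants, hS]
    obtain ⟨σ, hσ⟩ := exists_perm_wl hGH
    rw [hv, hv, ← Equiv.sum_comp σ B]
    exact Finset.sum_congr rfl fun x _ => hAB _ _ (hσ x)
  · have hc := Finset.card_lt_univ_of_notMem (s := S) (not_forall.1 fun h' =>
      hS (Finset.eq_univ_iff_forall.2 h')).choose_spec
    rw [Fintype.card_fin] at hc
    exact sum_variants_eq_of_wl_eq hAB S (wl_eq_of_le (by omega) h)

end ColouredGraph

/-! ### Equality patterns and invariant kernels. -/

/-- Möbius inversion, in the form of existence: every function on a finite partial order is a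
cumulative sum. -/
lemma exists_forall_sum_le_eq {α R : Type*} [Fintype α] [PartialOrder α] [DecidableLE α]
    [AddCommGroup R] (g : α → R) : ∃ a : α → R, ∀ q, ∑ p with p ≤ q, a p = g q := by
  classical
  let a : α → R := (wellFounded_lt (α := α)).fix fun q ih => g q - ∑ p : {p // p < q}, ih p p.2
  have ha : ∀ q, a q = g q - ∑ p with p < q, a p := by
    intro q
    rw [← Finset.sum_subtype_eq_sum_filter, Finset.subtype_univ]
    exact WellFounded.fix_eq _ _ q
  refine ⟨a, fun q => ?_⟩
  have : Finset.univ.filter (· ≤ q) = insert q (Finset.univ.filter (· < q)) := by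
    ext p; simp [le_iff_eq_or_lt]
  rw [this, Finset.sum_insert (by simp), ha q, sub_add_cancel]

lemma exists_perm_comp_eq_of_ker_eq {ι α : Type*} [Finite ι] {x y : ι → α}
    (h : Setoid.ker x = Setoid.ker y) : ∃ π : Equiv.Perm α, y = π ∘ x := by
  have hle : Setoid.ker x ≤ Setoid.ker y := h.le
  obtain ⟨π, hπ⟩ := Equiv.Perm.exists_extending_pair (Setoid.kerLift x) (Quotient.lift y hle)
    (Setoid.kerLift_injective x) ((Setoid.lift_injective_iff_ker_eq_of_le hle).2 h.symm)
  exact ⟨π, funext fun i => (hπ (Quotient.mk _ i)).symm⟩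

instance Setoid.instFinite {α : Type*} [Finite α] : Finite (Setoid α) :=
  Finite.of_injective (fun r : Setoid α => (r : α → α → Prop)) fun _ _ h =>
    Setoid.ext fun a b => iff_of_eq (congrFun (congrFun h a) b)

noncomputable instance Setoid.instFintype {α : Type*} [Finite α] : Fintype (Setoid α) :=
  Fintype.ofFinite _

open Classical in
/-- Functions invariant under permutations of the values are spanned by the indicators of the
conditions `P ≤ ker z`. -/
lemma exists_sum_le_ker_eq {ι α R : Type*} [Finite ι] [AddCommGroup R] (T : (ι → α) → R)
    (hT : ∀ (π : Equiv.Perm α) z, T (π ∘ z) = T z) :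
    ∃ a : Setoid ι → R, ∀ z, T z = ∑ P with P ≤ Setoid.ker z, a P := by
  obtain ⟨a, ha⟩ := exists_forall_sum_le_eq fun P : Setoid ι =>
    -- Patterns that are the kernel of no tuple get the arbitrary value 0; only values at actual
    -- kernels are used.
    if h : ∃ z : ι → α, Setoid.ker z = P then T h.choose else 0
  refine ⟨a, fun z => ?_⟩
  have h : ∃ z' : ι → α, Setoid.ker z' = Setoid.ker z := ⟨z, rfl⟩
  obtain ⟨π, hπ⟩ := exists_perm_comp_eq_of_ker_eq h.choose_spec
  rw [ha, dif_pos h]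
  conv_lhs => rw [hπ, hT]

/-- A pattern `P` on two `k`-tuples is realised, given the first tuple, by substituting into it:
positions in `S` are free and the second tuple is read off through `f`. -/
lemma exists_substitution {k : ℕ} (P : Setoid (Fin k ⊕ Fin k)) :
    ∃ (S : Finset (Fin k)) (f : Fin k → Fin k),
      (∀ j, f j ∉ S → P (.inr j) (.inl (f j))) ∧
      (∀ j, f j ∈ S → ∀ i, ¬ P (.inr j) (.inl i)) ∧
      (∀ j j', f j ∈ S → f j' ∈ S → (f j = f j' ↔ P (.inr j) (.inr j'))) ∧
      ∀ i ∈ S, ∃ j, f j = i := by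
  classical
  let bound : Fin k → Prop := fun j => ∃ i, P (.inr j) (.inl i)
  let b : Fin k → Fin k := fun j => if h : bound j then h.choose else j
  have hb : ∀ j, bound j → P (.inr j) (.inl (b j)) := fun j h => by
    simp only [b, dif_pos h]; exact h.choose_spec
  let ρ : Fin k → Fin k := fun j => (Quotient.mk (P.comap Sum.inr) j).out
  have hρ : ∀ j, P (.inr (ρ j)) (.inr j) := fun j =>
    Quotient.mk_out (s := P.comap Sum.inr) j
  have hρ' : ∀ j j', ρ j = ρ j' ↔ P (.inr j) (.inr j') := fun j j' => by
    refine ⟨fun h => P.trans (P.symm (hρ j)) (h ▸ hρ j'), fun h => ?_⟩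
    exact congrArg Quotient.out (Quotient.sound (s := P.comap Sum.inr) h)
  let R : Finset (Fin k) := (Finset.univ.filter fun j => ¬ bound j).image ρ
  let B : Finset (Fin k) := (Finset.univ.filter bound).image b
  -- There are at most as many free classes as unbound positions, and at most as many entries in use
  -- as bound positions. So the free classes fit into the unused entries, and `S` is chosen there.
  have hcard : R.card ≤ Bᶜ.card := by
    have h1 : R.card ≤ _ := Finset.card_image_le
    have h2 : B.card ≤ _ := Finset.card_image_le
    have h3 := Finset.card_filter_add_card_filter_not (s := (Finset.univ : Finset (Fin k))) bound
    rw [Finset.card_compl, Fintype.card_fin]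
    rw [Finset.card_univ, Fintype.card_fin] at h3
    omega
  obtain ⟨S, hSB, hS⟩ := Finset.exists_subset_card_eq hcard
  let e : R ≃ S := Finset.equivOfCardEq hS.symm
  have hR : ∀ j, ¬ bound j → ρ j ∈ R := fun j hj => Finset.mem_image_of_mem _ (by simpa using hj)
  let f : Fin k → Fin k := fun j => if h : bound j then b j else e ⟨ρ j, hR j h⟩
  have hf : ∀ j, bound j → f j = b j := fun j h => dif_pos h
  have hf' : ∀ j (h : ¬ bound j), f j = e ⟨ρ j, hR j h⟩ := fun j h => dif_neg h
  have hfS : ∀ j, f j ∈ S ↔ ¬ bound j := by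
    intro j
    by_cases h : bound j
    · simp only [hf j h, h, not_true, iff_false]
      intro hbS
      exact Finset.mem_compl.1 (hSB hbS) (Finset.mem_image_of_mem _ (by simpa using h))
    · simp only [hf' j h, h, not_false_iff, iff_true]
      exact (e _).2
  refine ⟨S, f, fun j hj => ?_, fun j hj i hi => (hfS j).1 hj ⟨i, hi⟩, fun j j' hj hj' => ?_,
    fun i hi => ?_⟩
  · have h : bound j := not_not.1 (mt (hfS j).2 hj)
    rw [hf j h]
    exact hb j h
  · rw [hf' j ((hfS j).1 hj), hf' j' ((hfS j').1 hj'), Subtype.coe_inj, e.apply_eq_iff_eq,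
      Subtype.mk_eq_mk, hρ']
  · obtain ⟨⟨r, hr⟩, her⟩ := e.surjective ⟨i, hi⟩
    obtain ⟨j, hj, rfl⟩ := Finset.mem_image.1 hr
    have hj : ¬ bound j := by simpa using hj
    exact ⟨j, by rw [hf' j hj, her]⟩

/-! ### Pattern sums are determined by colours. -/

namespace ColouredGraph

variable {n k : ℕ} {C : Type*} {G H : ColouredGraph n C}

-- The bijection is `x ↦ x ∘ f`: bound entries of `u` are read from unchanged positions of `v`, and
-- each free class has its own position in `S`. Every position in `S` is read, which gives
-- injectivity.
open Classical in
lemma exists_sum_pattern_eq (P : Setoid (Fin k ⊕ Fin k)) :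
    ∃ (S : Finset (Fin k)) (f : Fin k → Fin k), ∀ (v : Fin k → Fin n),
      P.comap Sum.inl ≤ Setoid.ker v → ∀ A : (Fin k → Fin n) → ℝ,
        ∑ u with P ≤ Setoid.ker (Sum.elim v u), A u = ∑ x ∈ variants S v, A (x ∘ f) := by
  obtain ⟨S, f, hbound, hfree, hinj, hsurj⟩ := exists_substitution P
  refine ⟨S, f, fun v hv A => (Finset.sum_bij (fun x _ => x ∘ f) ?_ ?_ ?_ fun _ _ => rfl).symm⟩
  · intro x hx
    rw [mem_variants] at hx
    have hmix : ∀ j i, P (.inr j) (.inl i) → x (f j) = v i := by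
      intro j i h
      have hj : f j ∉ S := fun hj => hfree j hj i h
      rw [hx _ hj]
      exact hv (P.trans (P.symm (hbound j hj)) h)
    refine Finset.mem_filter.2 ⟨Finset.mem_univ _, ?_⟩
    rintro (i | j) (i' | j') h
    · exact hv h
    · exact (hmix j' i (P.symm h)).symm
    · exact hmix j i' h
    · change x (f j) = x (f j')
      by_cases hj' : f j' ∈ S
      · by_cases hj : f j ∈ S
        · rw [(hinj j j' hj hj').2 h]
        · exact absurd (P.trans (P.symm h) (hbound j hj)) (hfree j' hj' _)
      · rw [hx _ hj']
        exact hmix j _ (P.trans h (hbound j' hj'))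
  · intro x hx y hy hxy
    rw [mem_variants] at hx hy
    ext1 i
    by_cases hi : i ∈ S
    · obtain ⟨j, rfl⟩ := hsurj i hi
      exact congrFun hxy j
    · rw [hx i hi, hy i hi]
  · intro u hu
    have hu : P ≤ Setoid.ker (Sum.elim v u) := (Finset.mem_filter.1 hu).2
    refine ⟨fun i => if hi : i ∈ S then u (hsurj i hi).choose else v i,
      mem_variants.2 fun i hi => dif_neg hi, funext fun j => ?_⟩
    by_cases hj : f j ∈ S
    · have hg := (hsurj _ hj).choose_spec
      have := (hinj _ j (hg.symm ▸ hj) hj).1 hg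
      simpa [hj] using hu this
    · simpa [hj] using (hu (hbound j hj)).symm

lemma sum_invariant_mul_eq {s : ℕ} (T : (Fin k ⊕ Fin k → Fin n) → ℝ)
    (hT : ∀ (π : Equiv.Perm (Fin n)) z, T (π ∘ z) = T z)
    {A B : (Fin k → Fin n) → ℝ} (hAB : ∀ x y, G.wl s x = H.wl s y → A x = B y)
    (hGH : WLEquiv k s G H) {v w : Fin k → Fin n}
    (h : G.wl (s + (k - 1)) v = H.wl (s + (k - 1)) w) :
    ∑ u, T (Sum.elim v u) * A u = ∑ u, T (Sum.elim w u) * B u := by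
  classical
  obtain ⟨a, ha⟩ := exists_sum_le_ker_eq T hT
  have key : ∀ (v : Fin k → Fin n) (A : (Fin k → Fin n) → ℝ), ∑ u, T (Sum.elim v u) * A u =
      ∑ P, a P * ∑ u with P ≤ Setoid.ker (Sum.elim v u), A u := by
    intro v A
    simp only [ha, Finset.sum_filter, Finset.sum_mul, Finset.mul_sum]
    rw [Finset.sum_comm]
    simp only [ite_mul, zero_mul, mul_ite, mul_zero]
  rw [key, key]
  refine Finset.sum_congr rfl fun P _ => congrArg _ ?_
  obtain ⟨S, f, hSf⟩ := exists_sum_pattern_eq (n := n) P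
  have hker := ker_eq_of_wl_eq h
  by_cases hv : P.comap Sum.inl ≤ Setoid.ker v
  · rw [hSf v hv, hSf w (hker ▸ hv)]
    exact sum_variants_eq (fun x y hxy => hAB _ _ (wl_comp_eq hxy f)) hGH S h
  -- If `v` violates the part of `P` on the first tuple, so does `w`, and both sums are empty.
  · have hempty : ∀ x : Fin k → Fin n, ¬ P.comap Sum.inl ≤ Setoid.ker x →
        (Finset.univ.filter fun u => P ≤ Setoid.ker (Sum.elim x u)) = ∅ := fun x hx =>
      Finset.filter_eq_empty_iff.2 fun u _ hu => hx fun i j hij => hu hij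
    rw [hempty v hv, hempty w (hker ▸ hv), Finset.sum_empty, Finset.sum_empty]

end ColouredGraph

/-! ### Equivariant layers and the network. -/

lemma LinearMap.featureTensor_apply_eq_sum {n k p : ℕ} {M : Type*} [AddCommGroup M] [Module ℝ M]
    (f : FeatureTensor n k p →ₗ[ℝ] M) (A : FeatureTensor n k p) :
    f A = ∑ a, ∑ u, A u a • f (Pi.single u (Pi.single a 1)) := by
  have hA : A = ∑ a, ∑ u, A u a • (Pi.single u (Pi.single a 1) : FeatureTensor n k p) := by
    ext v b
    simp [Finset.sum_apply, Pi.single_apply, Finset.sum_ite_eq]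
  conv_lhs => rw [hA]
  simp only [map_sum, map_smul]

namespace EquivariantLayer

variable {n k p q : ℕ} {C : Type*} {G H : ColouredGraph n C}

lemma perm_single (π : Equiv.Perm (Fin n)) (u : Fin k → Fin n) (x : Fin p → ℝ) :
    FeatureTensor.perm π (Pi.single u x : FeatureTensor n k p) = Pi.single (π ∘ u) x := by
  ext1 v
  have : (fun i => π.symm (v i)) = u ↔ v = π ∘ u := by
    simp only [funext_iff, Function.comp_apply, Equiv.symm_apply_eq]
  simp only [FeatureTensor.perm, Pi.single_apply, this]

lemma toAffineMap_eq (L : EquivariantLayer n k k p q) (A : FeatureTensor n k p) :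
    L.toAffineMap A = L.toAffineMap.linear A + L.toAffineMap 0 := by
  simpa using L.toAffineMap.map_vadd 0 A

lemma bias_perm (L : EquivariantLayer n k k p q) (π : Equiv.Perm (Fin n)) :
    (L.toAffineMap 0).perm π = L.toAffineMap 0 :=
  (L.equivariant π 0).symm

lemma linear_perm (L : EquivariantLayer n k k p q) (π : Equiv.Perm (Fin n))
    (A : FeatureTensor n k p) :
    L.toAffineMap.linear (A.perm π) = FeatureTensor.perm π (L.toAffineMap.linear A) := by
  have h := L.equivariant π A
  rw [toAffineMap_eq, toAffineMap_eq L A] at h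
  have h0 : FeatureTensor.perm π (L.toAffineMap.linear A + L.toAffineMap 0) =
      FeatureTensor.perm π (L.toAffineMap.linear A) + (L.toAffineMap 0).perm π := rfl
  rwa [h0, bias_perm, add_left_inj] at h

lemma perm_apply_comp (π : Equiv.Perm (Fin n)) (A : FeatureTensor n k p) (v : Fin k → Fin n) :
    A.perm π (π ∘ v) = A v := by
  simp [FeatureTensor.perm]

/-- An equivariant layer is refined by `k - 1` rounds of `k`-WL. -/
lemma apply_eq_of_wl_eq (L : EquivariantLayer n k k p q) {s : ℕ} {A B : FeatureTensor n k p}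
    (hAB : ∀ x y, G.wl s x = H.wl s y → A x = B y)
    (hGH : WLEquiv k s G H) {v w : Fin k → Fin n}
    (h : G.wl (s + (k - 1)) v = H.wl (s + (k - 1)) w) :
    L.toAffineMap A v = L.toAffineMap B w := by
  ext b
  -- Equal colours give equal kernels, so `w` is a relabelling of `v`, and the invariant bias takes
  -- the same value at both.
  obtain ⟨π, rfl⟩ := exists_perm_comp_eq_of_ker_eq (ColouredGraph.ker_eq_of_wl_eq h)
  have hbias : L.toAffineMap 0 v = L.toAffineMap 0 (π ∘ v) := by
    rw [← perm_apply_comp π (L.toAffineMap 0), bias_perm]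
  rw [toAffineMap_eq, toAffineMap_eq L B, Pi.add_apply, Pi.add_apply, hbias, Pi.add_apply,
    Pi.add_apply, add_left_inj, LinearMap.featureTensor_apply_eq_sum _ A,
    LinearMap.featureTensor_apply_eq_sum _ B]
  simp only [Finset.sum_apply, Pi.smul_apply, smul_eq_mul]
  refine Finset.sum_congr rfl fun a _ => ?_
  have key := ColouredGraph.sum_invariant_mul_eq (G := G) (H := H)
    -- The matrix coefficient from input `(u, a)` to output `(v, b)`, as a function of the joint
    -- tuple `(v, u)`.
    (fun z => L.toAffineMap.linear (Pi.single (z ∘ Sum.inr) (Pi.single a 1)) (z ∘ Sum.inl) b)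
    (fun π z => by
      rw [Function.comp_assoc, Function.comp_assoc, ← perm_single, linear_perm, perm_apply_comp])
    (A := fun u => A u a) (B := fun u => B u a) (fun x y hxy => congrFun (hAB x y hxy) a) hGH h
  simpa only [Sum.elim_comp_inl, Sum.elim_comp_inr, mul_comm] using key

end EquivariantLayer

lemma IGN.feature_eq_of_wl_eq {C : Type*} {n k d s : ℕ} (F : IGN n k d s)
    {G H : ColouredGraph n C} (c : Fin (F.width 0) → IsoType k C) {m : ℕ} (hm : m ≤ d) {t : ℕ}
    (ht : m * (k - 1) ≤ t) (hGH : WLEquiv k t G H) {v w : Fin k → Fin n}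
    (h : G.wl t v = H.wl t w) :
    F.feature m hm (G.tensor c) v = F.feature m hm (H.tensor c) w := by
  induction m generalizing t v w with
  | zero =>
    have h : G.isoType v = H.isoType w := ColouredGraph.wl_eq_of_le t.zero_le h
    ext a
    simp only [IGN.feature, ColouredGraph.tensor]
    rw [h]
  | succ m ih =>
    rw [Nat.succ_mul] at ht
    obtain ⟨r, rfl⟩ : ∃ r, t = r + (k - 1) := ⟨t - (k - 1), by omega⟩
    have hr : WLEquiv k r G H := hGH.mono (Nat.le_add_right _ _)
    ext a
    exact congrArg F.activation (congrFun ((F.layer m hm).apply_eq_of_wl_eq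
      (fun x y hxy => ih (Nat.le_of_succ_le hm) (by omega) hr hxy) hr h) a)

theorem lemma1 {C : Type*} {n k d s : ℕ} (hk : 2 ≤ k) (F : IGN n k d s)
    (G H : ColouredGraph n C)
    (c : Fin (F.width 0) → IsoType k C) (hc : Function.Injective c)
    (hG : ∀ v : Fin k → Fin n, G.isoType v ∈ Set.range c)
    (hH : ∀ w : Fin k → Fin n, H.isoType w ∈ Set.range c)
    (t : ℕ) (ht : t / (k - 1) ≤ d) (hGH : WLEquiv k t G H) :
    F.FeatureEquiv (t / (k - 1)) ht (G.tensor c) (H.tensor c) ∧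
      ∀ v w : Fin k → Fin n, G.wl t v = H.wl t w →
        F.feature (t / (k - 1)) ht (G.tensor c) v = F.feature (t / (k - 1)) ht (H.tensor c) w := by
  have key : ∀ v w : Fin k → Fin n, G.wl t v = H.wl t w →
      F.feature (t / (k - 1)) ht (G.tensor c) v = F.feature (t / (k - 1)) ht (H.tensor c) w :=
    fun v w h => F.feature_eq_of_wl_eq c ht (Nat.div_mul_le_self _ _) hGH h
  obtain ⟨σ, hσ⟩ := ColouredGraph.exists_perm_wl hGH
  exact ⟨map_univ_eq_of_perm σ fun v => key v _ (hσ v), key⟩
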